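/- Let $d\ge 1$ be an integer. Let $\mathrm{Sym}^t(\mathbb{C}^d)\subset(\mathbb{C}^d)^{\otimes t}$ be the subspace of tensors invariant under all permutations of the $t$ factors. A polynomial function of order $t$ on $\mathbb{C}^d$ is a function of the form $f(\psi)=\langle\psi^{\otimes t}|\,F\,|\psi^{\otimes t}\rangle$ with $F$ a linear operator on $\mathrm{Sym}^t(\mathbb{C}^d)$. A finite family $(\phi_k)_{k=1}^n$ of unit vectors of $\mathbb{C}^d$ is a (complex) spherical $t$-design if, for every polynomial function $f$ of order $t$, the average $\frac1n\sum_k f(\phi_k)$ equals the average of $f$ over the unit sphere of $\mathbb{C}^d$ with respect to the normalized uniform measure. A SIC-POVM in $\mathbb{C}^d$ is a family of $d^2$ unit vectors $\phi_k\in\mathbb{C}^d$ with $|\langle\phi_j|\phi_k\rangle|^2=\frac1{d+1}$ for all $j\ne k$. (i) Every SIC-POVM in $\mathbb{C}^d$ is a spherical 2-design. (ii) Conversely, every spherical 2-design in $\mathbb{C}^d$ with exactly $n=d^2$ elements is a SIC-POVM. (iii) In $\mathbb{R}^{d^2(d^2-1)}$, with coordinates $\lambda_{jk}$ indexed by the ordered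 pairs $j\neq k$ from $\{1,\dots,d^2\}$, the plane $\sum_{j\ne k}\lambda_{jk}=\frac{d^2(d^2-1)}{d+1}$ and the sphere $\sum_{j\ne k}\lambda_{jk}^2=\frac{d^2(d^2-1)}{(d+1)^2}$ meet in exactly one point, namely $\lambda_{jk}=\frac1{d+1}$ for all $j\neq k$. -/

import Mathlib

open MeasureTheory
open scoped InnerProductSpace

noncomputable section

/-- The Hilbert space `ℂ^d` with its standard inner product. -/
abbrev Hd (d : ℕ) : Type := EuclideanSpace ℂ (Fin d)

/-- The unit sphere of `ℂ^d`, that is, the set of all normalized vectors. -/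
abbrev UnitSphere (d : ℕ) : Type := Metric.sphere (0 : Hd d) 1

/-- The average of `f` over all normalized vectors of `ℂ^d`, with respect to the uniform measure
on the unit sphere (the surface measure of the sphere, which `⨍` normalizes to total mass one). -/
def sphereAverage (d : ℕ) (f : Hd d → ℂ) : ℂ :=
  ⨍ ψ : UnitSphere d, f ψ ∂((volume : Measure (Hd d)).toSphere)

/-- The `t`-fold tensor power of `ℂ^d`: coordinates with respect to the product basis
`e_{a 0} ⊗ ⋯ ⊗ e_{a (t-1)}`, which is orthonormal, are indexed by `a : Fin t → Fin d`. -/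
abbrev TensorHd (d t : ℕ) : Type := EuclideanSpace ℂ (Fin t → Fin d)

/-- The symmetric subspace of the tensor power: the tensors that are invariant under every
permutation of the `t` tensor factors. -/
def symSubspace (d t : ℕ) : Submodule ℂ (TensorHd d t) where
  carrier := {v | ∀ (σ : Equiv.Perm (Fin t)) (a : Fin t → Fin d), v (a ∘ σ) = v a}
  add_mem' hv hw σ a := by simp only [PiLp.add_apply, hv σ a, hw σ a]
  zero_mem' _ _ := rfl
  smul_mem' c v hv σ a := by simp only [PiLp.smul_apply, hv σ a]

/-- The tensor power `ψ^{⊗ t}` of a vector, as an element of the symmetric subspace. -/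
def tensorPow {d : ℕ} (t : ℕ) (ψ : Hd d) : symSubspace d t :=
  ⟨WithLp.toLp 2 (fun a => ∏ i, ψ (a i)), fun σ a =>
    Equiv.prod_comp σ (fun i => ψ (a i))⟩

/-- A polynomial function of order `t` on `ℂ^d`: a function `ψ ↦ ⟨ψ^{⊗ t}| F |ψ^{⊗ t}⟩` for some
linear operator `F` on the symmetric subspace. -/
def IsPolynomialOfOrder (d t : ℕ) (f : Hd d → ℂ) : Prop :=
  ∃ F : symSubspace d t →ₗ[ℂ] symSubspace d t,
    ∀ ψ : Hd d, f ψ = ⟪tensorPow t ψ, F (tensorPow t ψ)⟫_ℂ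

/-- A (complex) spherical `t`-design in `ℂ^d`: a finite family of normalized vectors such that
every polynomial function of order `t` has the same average over the family as over all
normalized vectors. -/
structure IsSphericalDesign {ι : Type*} [Fintype ι] {d : ℕ} (t : ℕ) (φ : ι → Hd d) : Prop where
  norm_eq_one : ∀ k, ‖φ k‖ = 1
  average_eq : ∀ f : Hd d → ℂ, IsPolynomialOfOrder d t f →
    (∑ k, f (φ k)) / (Fintype.card ι : ℂ) = sphereAverage d f

/-- A SIC-POVM in `ℂ^d`: `d²` normalized vectors with `|⟨φ_j|φ_k⟩|² = 1/(d+1)` for `j ≠ k`. -/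
structure IsSICPOVM {ι : Type*} [Fintype ι] {d : ℕ} (φ : ι → Hd d) : Prop where
  card_eq : Fintype.card ι = d ^ 2
  norm_eq_one : ∀ k, ‖φ k‖ = 1
  overlap_eq : ∀ j k, j ≠ k → ‖⟪φ j, φ k⟫_ℂ‖ ^ 2 = 1 / ((d : ℝ) + 1)

end

/-! Let `X ψ` be the operator `|ψ⊗ψ⟩⟨ψ⊗ψ|` viewed as a vector; then `⟪X φ, X ψ⟫ = |⟨φ|ψ⟩|⁴`, and
polynomial functions of order 2 are linear in `X`. Let `P` be the mean of `X` over the sphere. By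
unitary invariance `⟪X v, P⟫ = A = 2/(d(d+1))` for every unit `v`, hence `⟪P, P⟫ = A`. (i) For a
SIC, `∑ k, |⟨φ_j|φ_k⟩|⁴ = 1 + (d²-1)/(d+1)² = d² A`, so `D = ∑ k, X (φ k) - d² P` is orthogonal to
every `X (φ j)` and to `P`, therefore to itself, and `D = 0`. (ii) Testing a design on `|⟨φ_j|ψ⟩|⁴`
and `|⟨φ_j|ψ⟩|²‖ψ‖²` determines `∑ k, (|⟨φ_j|φ_k⟩|² - 1/(d+1))²`; the term `k = j` already exhausts
it. (iii) On the intersection `∑ (λ - 1/(d+1))²` expands to zero. -/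

/-- The restriction of a unitary map to the unit sphere. -/
noncomputable def sphereHomeomorph {d : ℕ} (U : Hd d ≃ₗᵢ[ℂ] Hd d) : UnitSphere d ≃ₜ UnitSphere d :=
  U.toHomeomorph.subtype fun x => by simp

-- The surface measure of `s` is a multiple of the volume of the cone over `s`; a unitary maps cones
-- to cones and preserves volume.
open scoped Pointwise in
theorem measurePreserving_sphereHomeomorph {d : ℕ} (U : Hd d ≃ₗᵢ[ℂ] Hd d) :
    MeasurePreserving (sphereHomeomorph U) (volume : Measure (Hd d)).toSphere
      (volume : Measure (Hd d)).toSphere := by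
  have hm : Measurable (sphereHomeomorph U) := (sphereHomeomorph U).continuous.measurable
  refine ⟨hm, Measure.ext fun s hs => ?_⟩
  let V : Hd d ≃ₗᵢ[ℝ] Hd d :=
    { U.toLinearEquiv.restrictScalars ℝ with norm_map' := U.norm_map }
  have hV : MeasurePreserving V volume volume := V.measurePreserving
  rw [Measure.map_apply hm hs, Measure.toSphere_apply' _ (hm hs), Measure.toSphere_apply' _ hs,
    ← hV.measure_preimage_emb V.toHomeomorph.measurableEmbedding
      (Set.Ioo (0 : ℝ) 1 • (Subtype.val '' s))]
  congr 2
  ext x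
  simp only [Set.mem_smul, Set.mem_image, Set.mem_preimage]
  constructor
  · rintro ⟨r, hr, _, ⟨y, hy, rfl⟩, rfl⟩
    exact ⟨r, hr, _, ⟨_, hy, rfl⟩, (V.map_smul r (y : Hd d)).symm⟩
  · rintro ⟨r, hr, _, ⟨y, hy, rfl⟩, h⟩
    refine ⟨r, hr, _, ⟨(sphereHomeomorph U).symm y, by simpa using hy, rfl⟩, V.injective ?_⟩
    rw [← h, V.map_smul]
    congr 1
    exact U.apply_symm_apply y

/-- The uniform probability measure on the unit sphere of `ℂ^d`. -/
noncomputable def uniformSphere (d : ℕ) : Measure (UnitSphere d) :=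
  ((volume : Measure (Hd d)).toSphere Set.univ)⁻¹ • (volume : Measure (Hd d)).toSphere

theorem sphereAverage_eq_integral (d : ℕ) (f : Hd d → ℂ) :
    sphereAverage d f = ∫ ψ : UnitSphere d, f ψ ∂uniformSphere d := rfl

instance isFiniteMeasure_uniformSphere (d : ℕ) : IsFiniteMeasure (uniformSphere d) := by
  unfold uniformSphere
  infer_instance

theorem isProbabilityMeasure_uniformSphere {d : ℕ} (hd : 1 ≤ d) :
    IsProbabilityMeasure (uniformSphere d) := by
  have : Nonempty (Fin d) := ⟨⟨0, hd⟩⟩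
  have : NeZero (volume : Measure (Hd d)).toSphere := ⟨Measure.toSphere_ne_zero _⟩
  unfold uniformSphere
  infer_instance

theorem integral_comp_unitary {d : ℕ} {E : Type*} [NormedAddCommGroup E] [NormedSpace ℝ E]
    (U : Hd d ≃ₗᵢ[ℂ] Hd d) (f : Hd d → E) :
    ∫ ψ : UnitSphere d, f (U ψ) ∂uniformSphere d = ∫ ψ : UnitSphere d, f ψ ∂uniformSphere d := by
  have h : MeasurePreserving (sphereHomeomorph U) (uniformSphere d) (uniformSphere d) :=
    (measurePreserving_sphereHomeomorph U).smul_measure _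
  exact h.integral_comp (sphereHomeomorph U).measurableEmbedding fun ψ => f ψ

theorem integrable_uniformSphere {d : ℕ} {E : Type*} [NormedAddCommGroup E] {f : Hd d → E}
    (hf : Continuous f) : Integrable (fun ψ : UnitSphere d => f ψ) (uniformSphere d) := by
  have : Continuous fun ψ : UnitSphere d => f ψ := hf.comp continuous_subtype_val
  exact this.integrable_of_hasCompactSupport (HasCompactSupport.of_compactSpace _)

/-- The distribution of a coordinate in a unit direction does not depend on the direction. -/
theorem integral_inner_eq_integral_coord {d : ℕ} {E : Type*} [NormedAddCommGroup E]
    [NormedSpace ℝ E] (g : ℂ → E) {v : Hd d} (hv : ‖v‖ = 1) (i : Fin d) :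
    ∫ ψ : UnitSphere d, g ⟪v, (ψ : Hd d)⟫_ℂ ∂uniformSphere d =
      ∫ ψ : UnitSphere d, g ((ψ : Hd d) i) ∂uniformSphere d := by
  -- Extend `v`, placed at index `i`, to an orthonormal basis `b`; the unitary `b.repr` has `⟪v, ψ⟫`
  -- as its `i`-th coordinate.
  have ho : Orthonormal ℂ (({i} : Set (Fin d)).domRestrict fun _ : Fin d => v) :=
    ⟨fun _ => hv, fun a b hab => (hab (Subsingleton.elim a b)).elim⟩
  obtain ⟨b, hb⟩ := ho.exists_orthonormalBasis_extension_of_card_eq (by simp)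
  rw [← integral_comp_unitary b.repr fun ψ => g (ψ i)]
  simp only [b.repr_apply_apply, hb i rfl]

/-! ### Second and fourth moments on the sphere -/

theorem integral_norm_inner_sq {d : ℕ} (hd : 1 ≤ d) {v : Hd d} (hv : ‖v‖ = 1) :
    ∫ ψ : UnitSphere d, ‖⟪v, (ψ : Hd d)⟫_ℂ‖ ^ 2 ∂uniformSphere d = 1 / d := by
  have := isProbabilityMeasure_uniformSphere hd
  have hd0 : (d : ℝ) ≠ 0 := by positivity
  have h1 : ∑ i : Fin d, ∫ ψ : UnitSphere d, ‖(ψ : Hd d) i‖ ^ 2 ∂uniformSphere d = 1 := by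
    rw [← integral_finsetSum _ fun i _ =>
      integrable_uniformSphere (f := fun ψ : Hd d => ‖ψ i‖ ^ 2) (by fun_prop)]
    simp [← EuclideanSpace.norm_sq_eq]
  simp_rw [← integral_inner_eq_integral_coord (fun z => ‖z‖ ^ 2) hv] at h1
  rw [Finset.sum_const, Finset.card_univ, Fintype.card_fin, nsmul_eq_mul] at h1
  field_simp
  linarith

/-- Summing over the fourth roots of unity cancels every term that depends on the relative phase of
`x` and `y`. -/
theorem norm_pow_four_sum_phases (x y : ℂ) :
    ‖x + y‖ ^ 4 + ‖x - y‖ ^ 4 + ‖x + Complex.I * y‖ ^ 4 + ‖x - Complex.I * y‖ ^ 4 =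
      4 * ‖x‖ ^ 4 + 4 * ‖y‖ ^ 4 + 16 * (‖x‖ ^ 2 * ‖y‖ ^ 2) := by
  have h : ∀ z : ℂ, ‖z‖ ^ 4 = (z.re * z.re + z.im * z.im) ^ 2 := fun z => by
    rw [← Complex.normSq_apply, Complex.normSq_eq_norm_sq]; ring
  have h' : ∀ z : ℂ, ‖z‖ ^ 2 = z.re * z.re + z.im * z.im := fun z => by
    rw [← Complex.normSq_apply, Complex.normSq_eq_norm_sq]
  simp only [h, h', Complex.add_re, Complex.add_im, Complex.sub_re, Complex.sub_im,
    Complex.mul_re, Complex.mul_im, Complex.I_re, Complex.I_im]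
  ring

theorem integral_norm_inner_pow_four_of_norm_sq {d : ℕ} {v : Hd d} (hv : ‖v‖ ^ 2 = 2)
    (i : Fin d) :
    ∫ ψ : UnitSphere d, ‖⟪v, (ψ : Hd d)⟫_ℂ‖ ^ 4 ∂uniformSphere d =
      4 * ∫ ψ : UnitSphere d, ‖(ψ : Hd d) i‖ ^ 4 ∂uniformSphere d := by
  have hv0 : ‖v‖ ≠ 0 := fun h => by norm_num [h] at hv
  have hu : ‖((‖v‖⁻¹ : ℝ) : ℂ) • v‖ = 1 := by
    rw [norm_smul, Complex.norm_real, norm_inv, norm_norm, inv_mul_cancel₀ hv0]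
  rw [← integral_inner_eq_integral_coord (fun z => ‖z‖ ^ 4) hu i, ← integral_const_mul]
  congr 1 with ψ
  have h4 : ‖v‖ ^ 4 = 4 := by rw [show ‖v‖ ^ 4 = (‖v‖ ^ 2) ^ 2 by ring, hv]; norm_num
  rw [inner_smul_left, norm_mul, mul_pow, RCLike.norm_conj, Complex.norm_real, norm_inv, norm_norm,
    inv_pow, h4]
  ring

/-- With `M` the fourth moment of a coordinate, each phase `z` contributes `4 M`, since the vector
involved has squared norm 2. The four-phase identity then reads `16 M = 8 M + 16 · mixed`. -/
theorem integral_coord_mixed {d : ℕ} {i j : Fin d} (hij : i ≠ j) :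
    2 * ∫ ψ : UnitSphere d, ‖(ψ : Hd d) i‖ ^ 2 * ‖(ψ : Hd d) j‖ ^ 2 ∂uniformSphere d =
      ∫ ψ : UnitSphere d, ‖(ψ : Hd d) i‖ ^ 4 ∂uniformSphere d := by
  have key : ∀ z : ℂ, ‖z‖ = 1 →
      ∫ ψ : UnitSphere d, ‖(ψ : Hd d) i + z * (ψ : Hd d) j‖ ^ 4 ∂uniformSphere d =
      4 * ∫ ψ : UnitSphere d, ‖(ψ : Hd d) i‖ ^ 4 ∂uniformSphere d := fun z hz => by
    -- The conjugate makes `⟪v, ψ⟫ = ψ i + z * ψ j`, the inner product being conjugate-linear on the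
    -- left.
    let v : Hd d := EuclideanSpace.single i 1 + EuclideanSpace.single j (starRingEnd ℂ z)
    have hv : ‖v‖ ^ 2 = 2 := by
      have h := @norm_add_sq ℂ (Hd d) _ _ _ (EuclideanSpace.single i 1)
        (EuclideanSpace.single j (starRingEnd ℂ z))
      simp only [EuclideanSpace.inner_single_left, PiLp.norm_single] at h
      simp [v, h, hij, hz]
      norm_num
    rw [← integral_norm_inner_pow_four_of_norm_sq hv i]
    simp [v, EuclideanSpace.inner_single_left]
  have hI : ∀ f : Hd d → ℝ, Continuous f →
      Integrable (fun ψ : UnitSphere d => f ψ) (uniformSphere d) := fun f => integrable_uniformSphere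
  have hz : ∀ z : ℂ, Integrable (fun ψ : UnitSphere d => ‖(ψ : Hd d) i + z * (ψ : Hd d) j‖ ^ 4)
      (uniformSphere d) := fun z => hI (fun ψ => ‖ψ i + z * ψ j‖ ^ 4) (by fun_prop)
  have hc : ∀ k : Fin d, Integrable (fun ψ : UnitSphere d => 4 * ‖(ψ : Hd d) k‖ ^ 4)
      (uniformSphere d) := fun k => hI (fun ψ => 4 * ‖ψ k‖ ^ 4) (by fun_prop)
  have hm : Integrable (fun ψ : UnitSphere d => 16 * (‖(ψ : Hd d) i‖ ^ 2 * ‖(ψ : Hd d) j‖ ^ 2))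
      (uniformSphere d) := hI (fun ψ => 16 * (‖ψ i‖ ^ 2 * ‖ψ j‖ ^ 2)) (by fun_prop)
  have hs : ∀ k : Fin d, ∫ ψ : UnitSphere d, ‖(ψ : Hd d) k‖ ^ 4 ∂uniformSphere d =
      ∫ ψ : UnitSphere d, ‖(ψ : Hd d) i‖ ^ 4 ∂uniformSphere d := fun k => by
    have hk : ‖(EuclideanSpace.single i 1 : Hd d)‖ = 1 := by simp
    rw [← integral_inner_eq_integral_coord (fun z => ‖z‖ ^ 4) hk,
      ← integral_inner_eq_integral_coord (fun z => ‖z‖ ^ 4) hk]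
  have h : ∫ ψ : UnitSphere d, (‖(ψ : Hd d) i + 1 * (ψ : Hd d) j‖ ^ 4 +
      ‖(ψ : Hd d) i + -1 * (ψ : Hd d) j‖ ^ 4 + ‖(ψ : Hd d) i + Complex.I * (ψ : Hd d) j‖ ^ 4 +
      ‖(ψ : Hd d) i + -Complex.I * (ψ : Hd d) j‖ ^ 4) ∂uniformSphere d =
      16 * ∫ ψ : UnitSphere d, ‖(ψ : Hd d) i‖ ^ 4 ∂uniformSphere d := by
    rw [integral_add (((hz _).fun_add (hz _)).fun_add (hz _)) (hz _),
      integral_add ((hz _).fun_add (hz _)) (hz _), integral_add (hz _) (hz _), key 1 (by simp),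
      key (-1) (by simp), key Complex.I (by simp), key (-Complex.I) (by simp)]
    ring
  simp only [one_mul, neg_mul, ← sub_eq_add_neg, norm_pow_four_sum_phases] at h
  rw [integral_add ((hc i).fun_add (hc j)) hm, integral_add (hc i) (hc j), integral_const_mul,
    integral_const_mul, integral_const_mul, hs j] at h
  linarith

/-- Integrating `(∑ i, |ψ i|²)² = 1` gives `d² A/2 + d A/2 = 1`. -/
theorem integral_norm_inner_pow_four {d : ℕ} (hd : 1 ≤ d) {v : Hd d} (hv : ‖v‖ = 1) :
    ∫ ψ : UnitSphere d, ‖⟪v, (ψ : Hd d)⟫_ℂ‖ ^ 4 ∂uniformSphere d = 2 / (d * (d + 1)) := by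
  have := isProbabilityMeasure_uniformSphere hd
  set A := ∫ ψ : UnitSphere d, ‖⟪v, (ψ : Hd d)⟫_ℂ‖ ^ 4 ∂uniformSphere d with hA
  have hs : ∀ k : Fin d, ∫ ψ : UnitSphere d, ‖(ψ : Hd d) k‖ ^ 4 ∂uniformSphere d = A := fun k => by
    rw [← integral_inner_eq_integral_coord (fun z => ‖z‖ ^ 4) hv k]
  have hp : ∀ i j : Fin d,
      ∫ ψ : UnitSphere d, ‖(ψ : Hd d) i‖ ^ 2 * ‖(ψ : Hd d) j‖ ^ 2 ∂uniformSphere d =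
        A / 2 + if i = j then A / 2 else 0 := fun i j => by
    split_ifs with hij
    · subst hij
      simp only [← pow_add, Nat.reduceAdd, hs]
      ring
    · linarith [integral_coord_mixed hij, hs i]
  have h1 : ∑ i : Fin d, ∑ j : Fin d,
      ∫ ψ : UnitSphere d, ‖(ψ : Hd d) i‖ ^ 2 * ‖(ψ : Hd d) j‖ ^ 2 ∂uniformSphere d = 1 := by
    have hI : ∀ i j : Fin d, Integrable
        (fun ψ : UnitSphere d => ‖(ψ : Hd d) i‖ ^ 2 * ‖(ψ : Hd d) j‖ ^ 2) (uniformSphere d) :=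
      fun i j => integrable_uniformSphere (f := fun ψ : Hd d => ‖ψ i‖ ^ 2 * ‖ψ j‖ ^ 2)
        (by fun_prop)
    simp_rw [← integral_finsetSum _ fun j _ => hI _ j]
    rw [← integral_finsetSum _ fun i _ => integrable_finsetSum _ fun j _ => hI i j]
    simp [← Finset.mul_sum, ← EuclideanSpace.norm_sq_eq]
  simp only [hp, Finset.sum_add_distrib, Finset.sum_const, Finset.card_univ, Fintype.card_fin,
    nsmul_eq_mul, Finset.sum_ite_eq, Finset.mem_univ, if_true] at h1
  have hd0 : (d : ℝ) ≠ 0 := by positivity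
  rw [eq_div_iff (by positivity)]
  linarith

/-! ### Polynomial functions as linear functionals, and test polynomials -/

theorem inner_tensorPow {d : ℕ} (t : ℕ) (φ ψ : Hd d) :
    ⟪tensorPow t φ, tensorPow t ψ⟫_ℂ = ⟪φ, ψ⟫_ℂ ^ t := by
  rw [Submodule.coe_inner, PiLp.inner_apply, PiLp.inner_apply, Fintype.sum_pow]
  refine Finset.sum_congr rfl fun a _ => ?_
  simp [tensorPow, Finset.prod_mul_distrib]

/-- The coordinates of the operator `|ψ^{⊗ t}⟩⟨ψ^{⊗ t}|`. -/
noncomputable def rankOneCoords {d : ℕ} (t : ℕ) (ψ : Hd d) :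
    EuclideanSpace ℂ ((Fin t → Fin d) × (Fin t → Fin d)) :=
  WithLp.toLp 2 fun p => starRingEnd ℂ ((tensorPow t ψ : TensorHd d t) p.1) *
    (tensorPow t ψ : TensorHd d t) p.2

theorem inner_rankOneCoords {d : ℕ} (t : ℕ) (φ ψ : Hd d) :
    ⟪rankOneCoords t φ, rankOneCoords t ψ⟫_ℂ = ((‖⟪φ, ψ⟫_ℂ‖ ^ (2 * t) : ℝ) : ℂ) := by
  have h : ⟪rankOneCoords t φ, rankOneCoords t ψ⟫_ℂ =
      starRingEnd ℂ ⟪tensorPow t φ, tensorPow t ψ⟫_ℂ * ⟪tensorPow t φ, tensorPow t ψ⟫_ℂ := by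
    rw [Submodule.coe_inner, PiLp.inner_apply, PiLp.inner_apply, map_sum, Finset.sum_mul_sum,
      Fintype.sum_prod_type]
    refine Finset.sum_congr rfl fun a _ => Finset.sum_congr rfl fun b _ => ?_
    simp only [rankOneCoords, RCLike.inner_apply, map_mul, RCLike.conj_conj]
    ring
  rw [h, inner_tensorPow, Complex.conj_mul', norm_pow]
  push_cast
  ring

theorem continuous_rankOneCoords {d t : ℕ} :
    Continuous (rankOneCoords t : Hd d → _) := by
  unfold rankOneCoords tensorPow
  fun_prop

theorem IsPolynomialOfOrder.exists_eq_inner {d t : ℕ} {f : Hd d → ℂ}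
    (hf : IsPolynomialOfOrder d t f) :
    ∃ W : EuclideanSpace ℂ ((Fin t → Fin d) × (Fin t → Fin d)),
      ∀ ψ, f ψ = ⟪W, rankOneCoords t ψ⟫_ℂ := by
  obtain ⟨F, hF⟩ := hf
  -- Extending `F` to the whole tensor space gives it a matrix in the product basis; `W` is the
  -- entrywise conjugate of that matrix.
  obtain ⟨G, hG⟩ := ((symSubspace d t).subtype ∘ₗ F).exists_extend
  refine ⟨WithLp.toLp 2 fun p => starRingEnd ℂ (G (EuclideanSpace.single p.2 1) p.1), fun ψ => ?_⟩
  have hx : ((F (tensorPow t ψ) : symSubspace d t) : TensorHd d t) = G (tensorPow t ψ) :=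
    (LinearMap.congr_fun hG (tensorPow t ψ)).symm
  have hs : (tensorPow t ψ : TensorHd d t) =
      ∑ b, (tensorPow t ψ : TensorHd d t) b • EuclideanSpace.single b (1 : ℂ) := by
    ext a
    simp [Pi.single_apply]
  rw [hF, Submodule.coe_inner, hx]
  conv_lhs => rw [hs, map_sum, ← hs]
  rw [PiLp.inner_apply, PiLp.inner_apply, Fintype.sum_prod_type]
  refine Finset.sum_congr rfl fun a _ => ?_
  simp only [rankOneCoords, RCLike.inner_apply, RCLike.conj_conj, map_smul, WithLp.ofLp_sum,
    WithLp.ofLp_smul, Finset.sum_apply, Pi.smul_apply, smul_eq_mul, Finset.sum_mul]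
  refine Finset.sum_congr rfl fun b _ => ?_
  ring

theorem isPolynomialOfOrder_norm_inner_sq {d t : ℕ} (w : TensorHd d t) :
    IsPolynomialOfOrder d t
      fun ψ => ((‖⟪w, (tensorPow t ψ : TensorHd d t)⟫_ℂ‖ ^ 2 : ℝ) : ℂ) := by
  -- This operator is the compression of `|w⟩⟨w|` to the symmetric subspace.
  refine ⟨((innerₛₗ ℂ w) ∘ₗ (symSubspace d t).subtype).smulRight
    ((symSubspace d t).orthogonalProjectionOnto w), fun ψ => ?_⟩
  have h : ⟪tensorPow t ψ, (symSubspace d t).orthogonalProjectionOnto w⟫_ℂ =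
      ⟪(tensorPow t ψ : TensorHd d t), w⟫_ℂ :=
    Submodule.inner_orthogonalProjectionOnto_eq_of_mem_left _ _
  rw [LinearMap.smulRight_apply, Submodule.coe_inner, Submodule.coe_smul, inner_smul_right,
    ← Submodule.coe_inner, h, LinearMap.comp_apply, Submodule.subtype_apply, innerₛₗ_apply_apply,
    ← inner_conj_symm _ w, Complex.mul_conj']
  exact Complex.ofReal_pow _ _

theorem IsPolynomialOfOrder.sum {d t : ℕ} {κ : Type*} (s : Finset κ) {f : κ → Hd d → ℂ}
    (hf : ∀ k, IsPolynomialOfOrder d t (f k)) : IsPolynomialOfOrder d t fun ψ => ∑ k ∈ s, f k ψ := by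
  choose F hF using hf
  refine ⟨∑ k ∈ s, F k, fun ψ => ?_⟩
  simp [hF, LinearMap.sum_apply]

theorem isPolynomialOfOrder_two_norm_inner_pow_four {d : ℕ} (v : Hd d) :
    IsPolynomialOfOrder d 2 fun ψ => ((‖⟪v, ψ⟫_ℂ‖ ^ 4 : ℝ) : ℂ) := by
  convert isPolynomialOfOrder_norm_inner_sq (tensorPow 2 v : TensorHd d 2) using 3 with ψ
  rw [← Submodule.coe_inner, inner_tensorPow, norm_pow, ← pow_mul]

/-- The factor `‖ψ‖²` raises the order from 1 to 2: the function is `∑ k, |⟨v ⊗ e_k | ψ ⊗ ψ⟩|²`. -/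
theorem isPolynomialOfOrder_two_norm_inner_sq {d : ℕ} (v : Hd d) :
    IsPolynomialOfOrder d 2 fun ψ => ((‖⟪v, ψ⟫_ℂ‖ ^ 2 * ‖ψ‖ ^ 2 : ℝ) : ℂ) := by
  convert IsPolynomialOfOrder.sum Finset.univ fun k : Fin d => isPolynomialOfOrder_norm_inner_sq
    (WithLp.toLp 2 fun a : Fin 2 → Fin d => v (a 0) * if a 1 = k then 1 else 0) using 2 with ψ
  rw [EuclideanSpace.norm_sq_eq, Finset.mul_sum, Complex.ofReal_sum]
  refine Finset.sum_congr rfl fun k _ => ?_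
  rw [← mul_pow, ← norm_mul]
  congr 3
  rw [PiLp.inner_apply, PiLp.inner_apply, ← (finTwoArrowEquiv (Fin d)).symm.sum_comp,
    Fintype.sum_prod_type, Finset.sum_mul]
  refine Finset.sum_congr rfl fun a _ => ?_
  simp [tensorPow, finTwoArrowEquiv, Fin.prod_univ_two, apply_ite (starRingEnd ℂ)]
  ring

/-! ### SIC-POVMs and 2-designs -/

theorem IsSICPOVM.sum_norm_inner_pow_four {d : ℕ} {ι : Type*} [Fintype ι]
    {φ : ι → Hd d} (h : IsSICPOVM φ) (hd : 1 ≤ d) (j : ι) :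
    ∑ k, ‖⟪φ j, φ k⟫_ℂ‖ ^ 4 = (d : ℝ) ^ 2 * (2 / (d * (d + 1))) := by
  classical
  have hk : ∀ k, ‖⟪φ j, φ k⟫_ℂ‖ ^ 4 =
      (1 / ((d : ℝ) + 1)) ^ 2 + if j = k then 1 - (1 / ((d : ℝ) + 1)) ^ 2 else 0 := fun k => by
    split_ifs with hjk
    · subst hjk
      simp [h.norm_eq_one]
    · rw [← h.overlap_eq j k hjk]
      ring
  have hd0 : (d : ℝ) ≠ 0 := by positivity
  simp only [hk, Finset.sum_add_distrib, Finset.sum_const, Finset.card_univ, h.card_eq,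
    nsmul_eq_mul, Finset.sum_ite_eq, Finset.mem_univ, if_true]
  push_cast
  field_simp
  ring

theorem IsSICPOVM.isSphericalDesign {d : ℕ} (hd : 1 ≤ d) {ι : Type*} [Fintype ι]
    {φ : ι → Hd d} (h : IsSICPOVM φ) : IsSphericalDesign 2 φ := by
  classical
  refine ⟨h.norm_eq_one, fun f hf => ?_⟩
  obtain ⟨W, hW⟩ := hf.exists_eq_inner
  have hp := isProbabilityMeasure_uniformSphere hd
  have hX := integrable_uniformSphere (continuous_rankOneCoords (d := d) (t := 2))
  set P := ∫ ψ : UnitSphere d, rankOneCoords 2 (ψ : Hd d) ∂uniformSphere d with hP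
  set A : ℝ := 2 / (d * (d + 1)) with hA
  have hd0 : (d : ℝ) ≠ 0 := by positivity
  have hd1 : (d : ℝ) + 1 ≠ 0 := by positivity
  have hPX : ∀ v : Hd d, ‖v‖ = 1 → ⟪rankOneCoords 2 v, P⟫_ℂ = (A : ℂ) := fun v hv => by
    rw [hP, ← integral_inner hX]
    simp only [inner_rankOneCoords]
    rw [integral_complex_ofReal, hA, ← integral_norm_inner_pow_four hd hv]
  have hPP : ⟪P, P⟫_ℂ = (A : ℂ) := by
    conv_lhs => rw [hP]
    rw [← hP, ← integral_inner hX]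
    -- The integrand is constant on the sphere, so its mean is `A`.
    have : ∀ ψ : UnitSphere d, ⟪P, rankOneCoords 2 (ψ : Hd d)⟫_ℂ = (A : ℂ) := fun ψ => by
      rw [← inner_conj_symm, hPX _ (norm_eq_of_mem_sphere ψ), Complex.conj_ofReal]
    simp [this]
  have hXD : ∀ j, ⟪rankOneCoords 2 (φ j), ∑ k, rankOneCoords 2 (φ k) - ((d : ℂ) ^ 2) • P⟫_ℂ = 0 :=
    fun j => by
    rw [inner_sub_right, inner_sum, inner_smul_right, hPX _ (h.norm_eq_one j)]
    simp only [inner_rankOneCoords]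
    rw [← Complex.ofReal_sum, h.sum_norm_inner_pow_four hd j]
    push_cast [hA]
    ring
  have hDP : ⟪∑ k, rankOneCoords 2 (φ k) - ((d : ℂ) ^ 2) • P, P⟫_ℂ = 0 := by
    rw [inner_sub_left, sum_inner, inner_smul_left, hPP]
    simp [hPX _ (h.norm_eq_one _), h.card_eq]
  have hS : ∑ k, rankOneCoords 2 (φ k) = ((d : ℂ) ^ 2) • P := by
    rw [← sub_eq_zero, ← inner_self_eq_zero (𝕜 := ℂ)]
    conv_lhs => rw [inner_sub_left, sum_inner, inner_smul_left, ← inner_conj_symm P]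
    simp [hXD, hDP]
  rw [sphereAverage_eq_integral]
  simp only [hW]
  rw [integral_inner hX, ← hP, ← inner_sum, hS, inner_smul_right, h.card_eq, Nat.cast_pow,
    mul_div_cancel_left₀]
  exact pow_ne_zero _ (by exact_mod_cast hd0)

theorem IsSphericalDesign.isSICPOVM {d : ℕ} (hd : 1 ≤ d) {ι : Type*} [Fintype ι]
    {φ : ι → Hd d} (h : IsSphericalDesign 2 φ) (hc : Fintype.card ι = d ^ 2) : IsSICPOVM φ := by
  classical
  have hd0 : (d : ℝ) ≠ 0 := by positivity
  have avg : ∀ g : Hd d → ℝ, IsPolynomialOfOrder d 2 (fun ψ => (g ψ : ℂ)) →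
      ∑ k, g (φ k) = (d : ℝ) ^ 2 * ∫ ψ : UnitSphere d, g ψ ∂uniformSphere d := fun g hg => by
    have e := h.average_eq _ hg
    rw [sphereAverage_eq_integral, integral_complex_ofReal, hc,
      div_eq_iff (by exact_mod_cast pow_ne_zero 2 (by positivity : d ≠ 0))] at e
    rw [mul_comm]
    exact_mod_cast e
  refine ⟨hc, h.norm_eq_one, fun j k hjk => ?_⟩
  have h4 := avg _ (isPolynomialOfOrder_two_norm_inner_pow_four (φ j))
  have h2 := avg _ (isPolynomialOfOrder_two_norm_inner_sq (φ j))
  rw [integral_norm_inner_pow_four hd (h.norm_eq_one j)] at h4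
  simp only [h.norm_eq_one, norm_eq_of_mem_sphere, one_pow, mul_one] at h2
  rw [integral_norm_inner_sq hd (h.norm_eq_one j)] at h2
  -- The right side equals the `k = j` term, so all other squares vanish.
  have hs : ∑ k, (‖⟪φ j, φ k⟫_ℂ‖ ^ 2 - 1 / ((d : ℝ) + 1)) ^ 2 = (1 - 1 / ((d : ℝ) + 1)) ^ 2 := by
    have e : ∀ k, (‖⟪φ j, φ k⟫_ℂ‖ ^ 2 - 1 / ((d : ℝ) + 1)) ^ 2 = ‖⟪φ j, φ k⟫_ℂ‖ ^ 4 -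
        2 / ((d : ℝ) + 1) * ‖⟪φ j, φ k⟫_ℂ‖ ^ 2 + (1 / ((d : ℝ) + 1)) ^ 2 := fun k => by ring
    simp only [e, Finset.sum_add_distrib, Finset.sum_sub_distrib, ← Finset.mul_sum, h4, h2,
      Finset.sum_const, Finset.card_univ, hc, nsmul_eq_mul]
    push_cast
    field_simp
    ring
  rw [← Finset.add_sum_erase _ _ (Finset.mem_univ j)] at hs
  have h1 : ‖⟪φ j, φ j⟫_ℂ‖ = 1 := by simp [h.norm_eq_one]
  rw [h1, one_pow, add_eq_left, Finset.sum_eq_zero_iff_of_nonneg fun _ _ => sq_nonneg _] at hs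
  have := hs k (Finset.mem_erase.2 ⟨hjk.symm, Finset.mem_univ k⟩)
  exact sub_eq_zero.1 (pow_eq_zero_iff two_ne_zero |>.1 this)

/-! ### Tangency of the plane and the sphere -/

theorem card_offDiag_subtype (ι : Type*) [Fintype ι] [DecidableEq ι] :
    (Fintype.card {p : ι × ι // p.1 ≠ p.2} : ℝ) =
      (Fintype.card ι : ℝ) * ((Fintype.card ι : ℝ) - 1) := by
  have h : Fintype.card {p : ι × ι // p.1 ≠ p.2} = (Finset.univ : Finset ι).offDiag.card :=
    Fintype.card_of_subtype _ fun p => by simp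
  rw [h, Finset.offDiag_card, Finset.card_univ, Nat.cast_sub (Nat.le_mul_self _)]
  push_cast
  ring

/-- A plane `∑ l = N c` is tangent to the sphere `∑ l ^ 2 = N c ^ 2` at the constant point. -/
theorem plane_inter_sphere_eq_singleton {κ : Type*} [Fintype κ] (c : ℝ) :
    {l : κ → ℝ | ∑ p, l p = Fintype.card κ * c} ∩
      {l : κ → ℝ | ∑ p, l p ^ 2 = Fintype.card κ * c ^ 2} = {fun _ => c} := by
  ext l
  simp only [Set.mem_inter_iff, Set.mem_ofPred_eq, Set.mem_singleton_iff]
  constructor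
  · rintro ⟨h1, h2⟩
    have hs : ∑ p, (l p - c) ^ 2 = 0 := by
      have e : ∀ p, (l p - c) ^ 2 = l p ^ 2 - 2 * c * l p + c ^ 2 := fun p => by ring
      simp only [e, Finset.sum_add_distrib, Finset.sum_sub_distrib, ← Finset.mul_sum, h1, h2,
        Finset.sum_const, Finset.card_univ, nsmul_eq_mul]
      ring
    rw [Finset.sum_eq_zero_iff_of_nonneg fun _ _ => sq_nonneg _] at hs
    ext p
    exact sub_eq_zero.1 (pow_eq_zero_iff two_ne_zero |>.1 (hs p (Finset.mem_univ p)))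
  · rintro rfl
    simp

theorem mainTheorem3 (d : ℕ) (hd : 1 ≤ d) {ι : Type*} [Fintype ι] [DecidableEq ι] :
    (∀ φ : ι → Hd d, IsSICPOVM φ → IsSphericalDesign 2 φ) ∧
    (∀ φ : ι → Hd d, IsSphericalDesign 2 φ → Fintype.card ι = d ^ 2 → IsSICPOVM φ) ∧
    (Fintype.card ι = d ^ 2 →
      {l : {p : ι × ι // p.1 ≠ p.2} → ℝ |
          ∑ p, l p = (d : ℝ) ^ 2 * ((d : ℝ) ^ 2 - 1) / ((d : ℝ) + 1)} ∩
        {l : {p : ι × ι // p.1 ≠ p.2} → ℝ |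
          ∑ p, l p ^ 2 = (d : ℝ) ^ 2 * ((d : ℝ) ^ 2 - 1) / ((d : ℝ) + 1) ^ 2} =
      {fun _ => 1 / ((d : ℝ) + 1)}) := by
  refine ⟨fun φ h => h.isSphericalDesign hd, fun φ h hc => h.isSICPOVM hd hc, fun hc => ?_⟩
  have h := plane_inter_sphere_eq_singleton (κ := {p : ι × ι // p.1 ≠ p.2}) (1 / ((d : ℝ) + 1))
  rw [card_offDiag_subtype, hc] at h
  simpa only [Nat.cast_pow, one_div, inv_pow, div_eq_mul_inv, one_mul] using h
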